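/- Let $\mathcal M=(E,\mathcal I)$ be a matroid on a finite set $E$ with rank function $\mathrm{rank}$ and rank $r=\mathrm{rank}(E)$. Its base polytope $P_B(\mathcal M)$ is the set of $x\in\mathbb R_{\ge 0}^{E}$ with $\sum_{e\in S}x(e)\le \mathrm{rank}(S)$ for all $S\subseteq E$ and $\sum_{e\in E}x(e)=r$. (1) For $z\in P_B(\mathcal M)$ let $R(z)$ be the random set that contains each $e\in E$ independently with probability $z(e)$. Then $\mathbb E[\mathrm{rank}(R(z))]\ge (1-1/e)\,r$, where $e$ on the right is Euler's number. (2) There is an absolute constant $C>0$ for which the following holds. Let $T$ be a number of time steps with $rT\ge 2$, and let $a(e)\ge 0$ (acquisition costs) and $c_t(e)\ge 0$ (holding costs) be reals for $e\in E$, $t\in[T]$. A solution to the multistage spanning set maintenance problem (MSM) is a family $S_1,\dots,S_T$ of spanning sets of $\mathcal M$; its cost is $\sum_{t}\big(\sum_{e\in S_t}c_t(e)+\sum_{e\in S_t\setminus S_{t-1}}a(e)\big)$ with $S_0=\emptyset$. Let $(y,z)$ be any feasible solution of the linear program LP2 $$\min\ \sum_{t,e}a(e)\,y_t(e)+\sum_{t,e}c_t(e)\,z_t(e)\quad\text{s.t.}\quad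 z_t\in P_B(\mathcal M),\quad y_t(e)\ge z_t(e)-z_{t-1}(e),\quad y_t(e),z_t(e)\ge 0,$$ for all $t\in[T]$, $e\in E$, where $z_0=0$, and let $V$ be its objective value. Put $L=32\ln(rT)$, choose thresholds $\tau_e$, $e\in E$, independently and uniformly from $[0,1/L]$, and let $\widehat S_t=\{e\in E: z_t(e)\ge\tau_e\}$. Let $S_t=\widehat S_t$ if $\widehat S_t$ is spanning, and otherwise let $S_t$ be obtained from $\widehat S_t$ by adding elements that make it spanning and have minimum total weight with respect to $c_t(e)+a(e)$. (Such an augmentation always exists; any rule that fixes an augmentation for each time and each set may be used.) Then: (a) for every $t\in[T]$, $\Pr[\widehat S_t\text{ is spanning}]\ge 1-(rT)^{-8}$; (b) $(S_t)_{t\in[T]}$ is always a solution to MSM, and its expected cost is at most $C\,\log(rT)\cdot V$. -/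

import Mathlib

open MeasureTheory

noncomputable section

namespace Multistage

variable {E : Type*} [Fintype E] [DecidableEq E]

/-- The rank of a set of elements, as a natural number (the ground type is finite). -/
def rk (M : Matroid E) (S : Finset E) : ℕ := (M.eRk (S : Set E)).toNat

/-- The rank of the matroid. -/
def rank (M : Matroid E) : ℕ := rk M Finset.univ

/-- The matroid polytope: nonnegative `x` with `x(S) ≤ rank(S)` for all `S ⊆ E`. -/
def matroidPolytope (M : Matroid E) : Set (E → ℝ) :=
  {x | (∀ e, 0 ≤ x e) ∧ ∀ S : Finset E, ∑ e ∈ S, x e ≤ (rk M S : ℝ)}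

/-- The base polytope: the points of the matroid polytope with `x(E) = rank(E)`. -/
def basePolytope (M : Matroid E) : Set (E → ℝ) :=
  matroidPolytope M ∩ {x | ∑ e, x e = (rank M : ℝ)}

/-- The probability that the random set containing each `e` independently with
probability `z e` is equal to `S`. -/
def sampleProb (z : E → ℝ) (S : Finset E) : ℝ :=
  (∏ e ∈ S, z e) * ∏ e ∈ Finset.univ \ S, (1 - z e)

/-- The expected rank of the random set `R(z)` containing each `e` independently with
probability `z e`. -/
def expectedRank (M : Matroid E) (z : E → ℝ) : ℝ :=
  ∑ S : Finset E, sampleProb z S * (rk M S : ℝ)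

/-- The value of a sequence at the preceding time step, with the value `x₀` standing before
the first step. -/
def prev {X : Type*} {T : ℕ} (x₀ : X) (s : Fin T → X) (t : Fin T) : X :=
  if t.val = 0 then x₀ else s ⟨t.val - 1, lt_of_le_of_lt (Nat.sub_le _ _) t.isLt⟩

/-- A solution to the multistage spanning set maintenance problem: a spanning set at every
time step. -/
def IsMSMSolution (M : Matroid E) {T : ℕ} (S : Fin T → Finset E) : Prop :=
  ∀ t, M.Spanning (S t : Set E)

/-- The cost `∑ₜ (cₜ(Sₜ) + a(Sₜ \ Sₜ₋₁))`, with `S₀ = ∅`. -/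
def msmCost {T : ℕ} (a : E → ℝ) (c : Fin T → E → ℝ) (S : Fin T → Finset E) : ℝ :=
  ∑ t, (∑ e ∈ S t, c t e + ∑ e ∈ S t \ prev ∅ S t, a e)

/-- Feasibility for the linear program: `zₜ` is in the base polytope,
`yₜ(e) ≥ zₜ(e) - zₜ₋₁(e)` with `z₀ = 0`, and `y, z ≥ 0`. -/
structure LPFeasible (M : Matroid E) {T : ℕ} (y z : Fin T → E → ℝ) : Prop where
  mem_base : ∀ t, z t ∈ basePolytope M
  acquire : ∀ t e, z t e - prev 0 z t e ≤ y t e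
  y_nonneg : ∀ t e, 0 ≤ y t e
  z_nonneg : ∀ t e, 0 ≤ z t e

/-- The objective `∑ a(e) yₜ(e) + ∑ cₜ(e) zₜ(e)` of the linear program. -/
def lpValue {T : ℕ} (a : E → ℝ) (c : Fin T → E → ℝ) (y z : Fin T → E → ℝ) : ℝ :=
  ∑ t, ∑ e, a e * y t e + ∑ t, ∑ e, c t e * z t e

/-- The law of independent thresholds `τ e`, each uniform on `[0, 1/L]`. -/
def thresholdLaw (E : Type*) [Fintype E] (L : ℝ) : Measure (E → ℝ) :=
  Measure.pi fun _ : E => ProbabilityTheory.cond volume (Set.Icc (0 : ℝ) (1 / L))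

/-- The threshold-rounded set `{e | z e ≥ τ e}`. -/
def roundedSet (z τ : E → ℝ) : Finset E := Finset.univ.filter fun e => τ e ≤ z e

/-- `Y` is a cheapest augmentation of `X` to a spanning set for the weights `w`: nothing is
added if `X` is spanning, and otherwise the added elements have minimum total weight. -/
structure IsCheapestAugmentation (M : Matroid E) (w : E → ℝ) (X Y : Finset E) : Prop where
  subset : X ⊆ Y
  spanning : M.Spanning (Y : Set E)
  eq_of_spanning : M.Spanning (X : Set E) → Y = X
  cheapest : ∀ Z : Finset E, X ⊆ Z → M.Spanning (Z : Set E) →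
    ∑ e ∈ Y \ X, w e ≤ ∑ e ∈ Z \ X, w e

/-- A rule that augments every set, at each time `t`, to a spanning set by adding
elements that are cheapest according to `cₜ(e) + a(e)`. -/
def IsAugmentationRule (M : Matroid E) {T : ℕ} (a : E → ℝ) (c : Fin T → E → ℝ)
    (aug : Fin T → Finset E → Finset E) : Prop :=
  ∀ t X, IsCheapestAugmentation M (fun e => c t e + a e) X (aug t X)

/-- The rounded solution: at each time, the threshold-rounded set, augmented. The same
thresholds are used at all times. -/
def roundedSolution {T : ℕ} (aug : Fin T → Finset E → Finset E) (z : Fin T → E → ℝ)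
    (τ : E → ℝ) (t : Fin T) : Finset E :=
  aug t (roundedSet (z t) τ)

end Multistage

end

/-!
Let `R` be the random set in which every element `e` arrives independently before time `s` at the
rate `z e`. An arrival of `e` raises the rank exactly when `e` lies outside the closure of `R`.
Since `z` has total mass `r` and its mass on the closure is at most `rank R`, the expected rank
grows at rate at least `r - rank R` (`rank_sub_rk_le_sum_gain`), so the expected missing rank decays
exponentially: `E[rank R] ≥ (1 - exp (-s)) * r` at time `s` (`le_expectedRank_arrivalProb`). By time
`s` the element `e` has arrived with probability `1 - exp (-s * z e) ≤ min 1 (s * z e)`, and the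
expected rank is monotone in the sampling probabilities, so the bound passes to sampling with
probabilities `min 1 (s * z e)` (`le_expectedRank_min`). At `s = 1` this is the claim about `R(z)`.

A threshold uniform on `[0, 1 / L]` is at most `z e` with probability `min 1 (L * z e)`, so at
`s = L` the bound concerns the rounded set. By Markov's inequality for the integer-valued missing
rank, the rounded set fails to be spanning with probability at most `r * exp (-L)` (`measureReal_not_spanning_le`).

For the cost, the rounded sets lose a factor `L` against the linear program, element by element
(`integral_msmCost_roundedSet_le`). An augmentation costs at most the minimum weight of a spanning
set. No integrality of the base polytope is needed to bound this minimum: the rounded set itself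
has expected weight at most `L * ∑ e, w e * z e` and spans with probability at least one half, so the
minimum is at most `2 * L * ∑ e, w e * z e` (`exists_spanning_sum_le`). The small failure
probability absorbs the factor `T` lost by charging acquisition costs anew at every time.
-/

namespace Multistage

open Finset

/-! ### Rank and closure in a matroid on a finite type -/

section Rank

lemma coe_rk {E : Type*} (M : Matroid E) (S : Finset E) : (rk M S : ℕ∞) = M.eRk (S : Set E) :=
  ENat.natCast_toNat (ne_top_of_le_ne_top (Set.encard_ne_top_iff.2 S.finite_toSet)
    (M.eRk_le_encard S))

lemma rk_mono {E : Type*} (M : Matroid E) : Monotone (rk M) := fun S S' h => by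
  have := M.eRk_mono (Finset.coe_subset.2 h)
  rw [← coe_rk, ← coe_rk] at this
  exact_mod_cast this

lemma rk_le_rank {E : Type*} [Fintype E] (M : Matroid E) (S : Finset E) : rk M S ≤ rank M :=
  rk_mono M (Finset.subset_univ S)

lemma rk_singleton_le_one {E : Type*} (M : Matroid E) (e : E) : rk M {e} ≤ 1 := by
  have := M.eRk_le_encard ({e} : Finset E)
  rw [← coe_rk, Set.encard_coe_eq_coe_finsetCard, card_singleton] at this
  exact_mod_cast this

variable {E : Type*} [Fintype E] {M : Matroid E}

lemma spanning_iff_rk (hM : M.E = Set.univ) (S : Finset E) :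
    M.Spanning (S : Set E) ↔ rank M ≤ rk M S := by
  have hS : (S : Set E) ⊆ M.E := by simp [hM]
  have : M.Finite := ⟨Set.toFinite _⟩
  rw [Matroid.spanning_iff_eRk_le hS, ← Matroid.eRk_univ_eq, ← coe_rk, rank,
    ← Finset.coe_univ, ← coe_rk, Nat.cast_le]

lemma spanning_univ (hM : M.E = Set.univ) : M.Spanning ((univ : Finset E) : Set E) :=
  (spanning_iff_rk hM _).2 le_rfl

/-- The mean gain in rank, when elements arrive at rates `z e`, is at least the missing rank:
the elements gaining nothing are those of the closure of `S`, and the rank constraint for this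
closure bounds their total rate. -/
lemma rank_sub_rk_le_sum_gain [DecidableEq E] (hM : M.E = Set.univ) {z : E → ℝ}
    (hz : z ∈ basePolytope M) (S : Finset E) :
    (rank M : ℝ) - rk M S ≤ ∑ e, z e * ((rk M (insert e S) : ℝ) - rk M S) := by
  classical
  set F : Finset E := univ.filter fun e => e ∈ M.closure (S : Set E) with hF
  have hFc : (F : Set E) = M.closure (S : Set E) := by ext; simp [hF]
  have hFr : rk M F = rk M S := by rw [rk, hFc, M.eRk_closure_eq, rk]
  have hF1 := hz.1.2 F
  rw [hFr] at hF1
  have hsum : ∑ e, z e = rank M := hz.2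
  have hgain : ∀ e, (z e - if e ∈ F then z e else 0) ≤
      z e * ((rk M (insert e S) : ℝ) - rk M S) := by
    intro e
    split_ifs with he
    · rw [sub_self]
      refine mul_nonneg (hz.1.1 e) (sub_nonneg.2 ?_)
      exact_mod_cast rk_mono M (subset_insert e S)
    · have h := M.eRk_insert_eq_add_one (e := e) (X := (S : Set E))
        ⟨by simp [hM], by simpa [hF] using he⟩
      rw [← Finset.coe_insert, ← coe_rk, ← coe_rk] at h
      have h' : rk M (insert e S) = rk M S + 1 := by exact_mod_cast h
      rw [h']
      push_cast
      linarith
  have hle := sum_le_sum fun e (_ : e ∈ univ) => hgain e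
  rw [sum_sub_distrib, sum_ite_mem, univ_inter, hsum] at hle
  linarith

end Rank

/-! ### The product law on subsets -/

section Sample

variable {E : Type*} [Fintype E] [DecidableEq E]

lemma sampleProb_eq_prod_ite (p : E → ℝ) (S : Finset E) :
    sampleProb p S = ∏ e, if e ∈ S then p e else 1 - p e := by
  rw [sampleProb, prod_ite, filter_mem_eq_inter, univ_inter]
  congr 2
  ext; simp

lemma sampleProb_nonneg {p : E → ℝ} (h0 : ∀ e, 0 ≤ p e) (h1 : ∀ e, p e ≤ 1) (S : Finset E) :
    0 ≤ sampleProb p S :=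
  mul_nonneg (prod_nonneg fun e _ => h0 e) (prod_nonneg fun e _ => sub_nonneg.2 (h1 e))

lemma sum_sampleProb (p : E → ℝ) : ∑ S : Finset E, sampleProb p S = 1 := by
  have h := prod_add p (fun e => 1 - p e) univ
  simp only [add_sub_cancel, prod_const_one, powerset_univ] at h
  exact h.symm

lemma sampleProb_eq_erase_mul (p : E → ℝ) (S : Finset E) (e : E) :
    sampleProb p S = (∏ j ∈ univ.erase e, if j ∈ S then p j else 1 - p j) *
      if e ∈ S then p e else 1 - p e := by
  rw [sampleProb_eq_prod_ite, prod_erase_mul _ _ (mem_univ e)]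

/-- The probability that a Poisson process of rate `z e` has an arrival before time `s`. -/
noncomputable def arrivalProb (z : E → ℝ) (s : ℝ) (e : E) : ℝ := 1 - Real.exp (-(s * z e))

/-- The forward equation of the process in which each element `e` arrives at rate `z e`: the set
`S` is entered from `S.erase e` if `e ∈ S`, and left towards `insert e S` if `e ∉ S`. -/
lemma hasDerivAt_sampleProb_arrivalProb (z : E → ℝ) (S : Finset E) (s : ℝ) :
    HasDerivAt (fun s => sampleProb (arrivalProb z s) S)
      (∑ e, z e * if e ∈ S then sampleProb (arrivalProb z s) (S.erase e)
        else -sampleProb (arrivalProb z s) S) s := by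
  have hexp : ∀ e, HasDerivAt (fun s => Real.exp (-(s * z e)))
      (Real.exp (-(s * z e)) * -z e) s := fun e => by
    simpa using (((hasDerivAt_id s).mul_const (z e)).neg).exp
  have hfac : ∀ e ∈ univ, HasDerivAt
      (fun s => if e ∈ S then arrivalProb z s e else 1 - arrivalProb z s e)
      (if e ∈ S then z e * Real.exp (-(s * z e)) else -(z e * Real.exp (-(s * z e)))) s := by
    intro e _
    split_ifs with he
    · exact ((hexp e).const_sub 1).congr_deriv (by ring)
    · simp only [arrivalProb, sub_sub_cancel]
      exact (hexp e).congr_deriv (by ring)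
  have h := HasDerivAt.fun_finsetProd hfac
  simp only [← sampleProb_eq_prod_ite] at h
  refine h.congr_deriv ?_
  refine sum_congr rfl fun e _ => ?_
  rw [smul_eq_mul]
  split_ifs with he
  · rw [sampleProb_eq_erase_mul _ _ e, if_neg (notMem_erase e S), arrivalProb, sub_sub_cancel]
    have : ∏ j ∈ univ.erase e, (if j ∈ S.erase e then arrivalProb z s j
        else 1 - arrivalProb z s j) =
        ∏ j ∈ univ.erase e, if j ∈ S then arrivalProb z s j else 1 - arrivalProb z s j :=
      prod_congr rfl fun j hj => by simp [ne_of_mem_erase hj]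
    rw [this]
    ring
  · rw [sampleProb_eq_erase_mul _ _ e, if_neg he, arrivalProb, sub_sub_cancel]
    ring

/-- Summation by parts on the Boolean lattice in the direction of `e`. -/
lemma sum_mul_ite_erase (e : E) (P f : Finset E → ℝ) :
    ∑ S : Finset E, (if e ∈ S then P (S.erase e) else -P S) * f S =
      ∑ S : Finset E, P S * (f (insert e S) - f S) := by
  have h1 : ∑ S : Finset E with e ∈ S, P (S.erase e) * f S =
      ∑ S : Finset E with e ∉ S, P S * f (insert e S) := by
    refine sum_nbij' (fun S => S.erase e) (fun S => insert e S) ?_ ?_ ?_ ?_ ?_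
    · simp
    · simp
    · intro S hS
      exact insert_erase (mem_filter.1 hS).2
    · intro S hS
      exact erase_insert (mem_filter.1 hS).2
    · intro S hS
      rw [insert_erase (mem_filter.1 hS).2]
  rw [← sum_filter_add_sum_filter_not univ (fun S : Finset E => e ∈ S),
    ← sum_filter_add_sum_filter_not univ (fun S : Finset E => e ∈ S)
      (fun S => P S * (f (insert e S) - f S))]
  have h2 : ∑ S : Finset E with e ∈ S, P S * (f (insert e S) - f S) = 0 :=
    sum_eq_zero fun S hS => by rw [insert_eq_self.2 (mem_filter.1 hS).2]; ring
  have h3 : ∑ S : Finset E with e ∈ S, (if e ∈ S then P (S.erase e) else -P S) * f S =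
      ∑ S : Finset E with e ∈ S, P (S.erase e) * f S :=
    sum_congr rfl fun S hS => by rw [if_pos (mem_filter.1 hS).2]
  rw [h2, h3, h1, zero_add, ← sum_add_distrib]
  refine sum_congr rfl fun S hS => ?_
  rw [if_neg (mem_filter.1 hS).2]
  ring

variable {M : Matroid E}

lemma hasDerivAt_expectedRank_arrivalProb (M : Matroid E) (z : E → ℝ) (s : ℝ) :
    HasDerivAt (fun s => expectedRank M (arrivalProb z s))
      (∑ S : Finset E, sampleProb (arrivalProb z s) S *
        ∑ e, z e * ((rk M (insert e S) : ℝ) - rk M S)) s := by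
  have h := HasDerivAt.fun_sum (u := univ) fun (S : Finset E) _ =>
    (hasDerivAt_sampleProb_arrivalProb z S s).mul_const (rk M S : ℝ)
  refine h.congr_deriv ?_
  have hcomm := fun e => congrArg (z e * ·) (sum_mul_ite_erase e
    (sampleProb (arrivalProb z s)) fun S => (rk M S : ℝ))
  simp only [mul_sum] at hcomm
  simp only [sum_mul, mul_sum, mul_assoc]
  rw [sum_comm, sum_congr rfl fun e _ => hcomm e, sum_comm]
  exact sum_congr rfl fun S _ => sum_congr rfl fun e _ => mul_left_comm _ _ _

/-- Along the arrival process the expected missing rank decays at rate at least one. -/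
lemma le_expectedRank_arrivalProb (hM : M.E = Set.univ) {z : E → ℝ} (hz : z ∈ basePolytope M)
    {s : ℝ} (hs : 0 ≤ s) :
    (1 - Real.exp (-s)) * (rank M : ℝ) ≤ expectedRank M (arrivalProb z s) := by
  have hp0 : ∀ u, 0 ≤ u → ∀ e, 0 ≤ arrivalProb z u e := fun u hu e => by
    have : Real.exp (-(u * z e)) ≤ 1 :=
      Real.exp_le_one_iff.2 (neg_nonpos.2 (mul_nonneg hu (hz.1.1 e)))
    simpa [arrivalProb] using this
  have hp1 : ∀ u, ∀ e, arrivalProb z u e ≤ 1 := fun u e => by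
    simpa [arrivalProb] using (Real.exp_pos (-(u * z e))).le
  have hP : ∀ u, 0 ≤ u → ∀ S, 0 ≤ sampleProb (arrivalProb z u) S := fun u hu S =>
    sampleProb_nonneg (hp0 u hu) (hp1 u) S
  have hder : ∀ u, HasDerivAt
      (fun u => Real.exp u * (expectedRank M (arrivalProb z u) - rank M)) _ u := fun u =>
    (Real.hasDerivAt_exp u).mul
      ((hasDerivAt_expectedRank_arrivalProb M z u).sub_const (rank M : ℝ))
  have hmono := monotoneOn_of_deriv_nonneg (convex_Ici (0 : ℝ))
    (f := fun u => Real.exp u * (expectedRank M (arrivalProb z u) - rank M))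
    (fun u _ => (hder u).continuousAt.continuousWithinAt)
    (fun u _ => (hder u).differentiableAt.differentiableWithinAt)
    (fun u hu => by
      rw [interior_Ici] at hu
      have hle := sum_le_sum fun (S : Finset E) (_ : S ∈ univ) =>
        mul_le_mul_of_nonneg_left (rank_sub_rk_le_sum_gain hM hz S) (hP u (le_of_lt hu) S)
      simp only [mul_sub] at hle
      rw [sum_sub_distrib, ← sum_mul, sum_sampleProb, one_mul] at hle
      simp only [← mul_sub] at hle
      change _ - expectedRank M _ ≤ _ at hle
      rw [(hder u).deriv, ← mul_add]
      exact mul_nonneg (Real.exp_pos u).le (by linarith))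
  have h0 : 0 ≤ expectedRank M (arrivalProb z 0) :=
    sum_nonneg fun S _ => mul_nonneg (hP 0 le_rfl S) (Nat.cast_nonneg _)
  have h := hmono (Set.mem_Ici.2 le_rfl) (Set.mem_Ici.2 hs) hs
  simp only [Real.exp_zero, one_mul] at h
  have h2 : Real.exp (-s) * (Real.exp s * (expectedRank M (arrivalProb z s) - rank M)) =
      expectedRank M (arrivalProb z s) - rank M := by
    rw [← mul_assoc, ← Real.exp_add, neg_add_cancel, Real.exp_zero, one_mul]
  have h3 := mul_le_mul_of_nonneg_left h (Real.exp_pos (-s)).le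
  rw [h2] at h3
  have h4 := mul_nonneg (Real.exp_pos (-s)).le h0
  linarith

end Sample

/-! ### Independent uniform thresholds -/

section Threshold

variable {E : Type*} [Fintype E]

lemma isProbabilityMeasure_cond_Icc {L : ℝ} (hL : 0 < L) :
    IsProbabilityMeasure (ProbabilityTheory.cond volume (Set.Icc (0 : ℝ) (1 / L))) := by
  have : 0 < 1 / L := one_div_pos.2 hL
  refine ProbabilityTheory.cond_isProbabilityMeasure_of_finite ?_ ?_
  · simpa using hL
  · simp

lemma isProbabilityMeasure_thresholdLaw {L : ℝ} (hL : 0 < L) :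
    IsProbabilityMeasure (thresholdLaw E L) := by
  have := isProbabilityMeasure_cond_Icc hL
  unfold thresholdLaw
  infer_instance

lemma cond_Icc_real_apply {L : ℝ} (hL : 0 < L) (s : Set ℝ) :
    (ProbabilityTheory.cond volume (Set.Icc (0 : ℝ) (1 / L))).real s =
      L * volume.real (Set.Icc 0 (1 / L) ∩ s) := by
  rw [Measure.real, ProbabilityTheory.cond_apply measurableSet_Icc, ENNReal.toReal_mul,
    Real.volume_Icc, sub_zero, ENNReal.toReal_inv,
    ENNReal.toReal_ofReal (one_div_pos.2 hL).le, one_div, inv_inv, Measure.real]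

lemma cond_Icc_real_Iic {L x : ℝ} (hL : 0 < L) (hx : 0 ≤ x) :
    (ProbabilityTheory.cond volume (Set.Icc (0 : ℝ) (1 / L))).real (Set.Iic x) =
      min 1 (L * x) := by
  rw [cond_Icc_real_apply hL]
  have : Set.Icc 0 (1 / L) ∩ Set.Iic x = Set.Icc 0 (min (1 / L) x) := by
    ext; simp [and_assoc]
  rw [this, Real.volume_real_Icc_of_le (le_min (one_div_pos.2 hL).le hx), sub_zero,
    mul_min_of_nonneg _ _ hL.le, mul_one_div_cancel hL.ne']

lemma cond_Icc_real_Ioc_le {L u v : ℝ} (hL : 0 < L) :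
    (ProbabilityTheory.cond volume (Set.Icc (0 : ℝ) (1 / L))).real (Set.Ioc u v) ≤
      L * max (v - u) 0 := by
  rw [cond_Icc_real_apply hL]
  refine mul_le_mul_of_nonneg_left ?_ hL.le
  refine (measureReal_mono Set.inter_subset_right (by simp)).trans ?_
  rw [Real.volume_real_Ioc]

lemma measureReal_thresholdLaw_eval {L : ℝ} (hL : 0 < L) (e : E) {s : Set ℝ}
    (hs : MeasurableSet s) :
    (thresholdLaw E L).real {τ | τ e ∈ s} =
      (ProbabilityTheory.cond volume (Set.Icc (0 : ℝ) (1 / L))).real s := by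
  have := isProbabilityMeasure_cond_Icc hL
  exact (measurePreserving_eval (fun _ : E =>
    ProbabilityTheory.cond volume (Set.Icc (0 : ℝ) (1 / L))) e).measureReal_preimage
      hs.nullMeasurableSet

lemma mem_roundedSet {z τ : E → ℝ} {e : E} : e ∈ roundedSet z τ ↔ τ e ≤ z e := by
  simp [roundedSet]

lemma roundedSet_mono {z z' : E → ℝ} (h : z ≤ z') (τ : E → ℝ) :
    roundedSet z τ ⊆ roundedSet z' τ := fun e he =>
  mem_roundedSet.2 ((mem_roundedSet.1 he).trans (h e))

/-- Only finitely many sets occur, each on a set of thresholds cut out by coordinate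
inequalities. -/
lemma measurable_comp_roundedSet {ι : Type*} [Finite ι] (z : ι → E → ℝ)
    (f : (ι → Finset E) → ℝ) : Measurable fun τ => f fun i => roundedSet (z i) τ := by
  let _ : MeasurableSpace (ι → Finset E) := ⊤
  refine (measurable_from_top (f := f)).comp (measurable_to_countable' fun A => ?_)
  have : (fun τ i => roundedSet (z i) τ) ⁻¹' {A} =
      ⋂ i, ⋂ e, {τ : E → ℝ | τ e ≤ z i e ↔ e ∈ A i} := by
    ext τ
    simp only [Set.mem_preimage, Set.mem_singleton_iff, Set.mem_iInter, Set.mem_ofPred_eq,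
      funext_iff, Finset.ext_iff, mem_roundedSet]
  rw [this]
  refine MeasurableSet.iInter fun i => MeasurableSet.iInter fun e => ?_
  exact (measurableSet_le (measurable_pi_apply e) measurable_const).iff (MeasurableSet.const _)

lemma integrable_comp_roundedSet {ι : Type*} [Finite ι] {L : ℝ} (hL : 0 < L) (z : ι → E → ℝ)
    (f : (ι → Finset E) → ℝ) :
    Integrable (fun τ => f fun i => roundedSet (z i) τ) (thresholdLaw E L) := by
  have := isProbabilityMeasure_thresholdLaw (E := E) hL
  obtain ⟨B, hB⟩ := (Set.finite_range fun A => ‖f A‖).bddAbove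
  exact Integrable.of_bound (measurable_comp_roundedSet z f).aestronglyMeasurable B
    (Filter.Eventually.of_forall fun τ => hB ⟨_, rfl⟩)

lemma integrable_comp_roundedSet_single {L : ℝ} (hL : 0 < L) (z : E → ℝ) (f : Finset E → ℝ) :
    Integrable (fun τ => f (roundedSet z τ)) (thresholdLaw E L) :=
  integrable_comp_roundedSet hL (fun _ : Unit => z) fun A => f (A ())

lemma measurableSet_roundedSet (z : E → ℝ) (P : Finset E → Prop) :
    MeasurableSet {τ | P (roundedSet z τ)} := by
  classical
  have h := measurable_comp_roundedSet (fun _ : Unit => z) (fun A => if P (A ()) then 1 else 0)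
    (measurableSet_singleton (1 : ℝ))
  convert h using 1
  ext τ
  by_cases hP : P (roundedSet z τ) <;> simp [hP]

variable [DecidableEq E]

/-- The rounded set has the law of independent sampling with probabilities `L * z e`, truncated
at one. -/
lemma measureReal_roundedSet_eq {L : ℝ} (hL : 0 < L) {z : E → ℝ} (hz : ∀ e, 0 ≤ z e)
    (S : Finset E) :
    (thresholdLaw E L).real {τ | roundedSet z τ = S} =
      sampleProb (fun e => min 1 (L * z e)) S := by
  have hprob := isProbabilityMeasure_cond_Icc hL
  have : {τ | roundedSet z τ = S} =
      Set.univ.pi fun e => if e ∈ S then Set.Iic (z e) else (Set.Iic (z e))ᶜ := by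
    ext τ
    simp only [Set.mem_ofPred_eq, Finset.ext_iff, mem_roundedSet, Set.mem_pi, Set.mem_univ,
      true_imp_iff]
    refine forall_congr' fun e => ?_
    by_cases he : e ∈ S <;> simp [he]
  rw [this, thresholdLaw, Measure.real, Measure.pi_pi, ENNReal.toReal_prod,
    sampleProb_eq_prod_ite]
  refine prod_congr rfl fun e _ => ?_
  change Measure.real _ _ = _
  split_ifs
  · exact cond_Icc_real_Iic hL (hz e)
  · rw [probReal_compl_eq_one_sub measurableSet_Iic, cond_Icc_real_Iic hL (hz e)]

lemma integral_roundedSet {L : ℝ} (hL : 0 < L) {z : E → ℝ} (hz : ∀ e, 0 ≤ z e)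
    (f : Finset E → ℝ) :
    ∫ τ, f (roundedSet z τ) ∂(thresholdLaw E L) =
      ∑ S, sampleProb (fun e => min 1 (L * z e)) S * f S := by
  have := isProbabilityMeasure_thresholdLaw (E := E) hL
  have h : ∀ τ, f (roundedSet z τ) =
      ∑ S, Set.indicator {τ | roundedSet z τ = S} (fun _ => f S) τ := fun τ => by
    simp [Set.indicator_apply]
  simp_rw [h]
  rw [integral_finsetSum]
  · refine sum_congr rfl fun S _ => ?_
    rw [integral_indicator_const _ (measurableSet_roundedSet z (· = S)),
      measureReal_roundedSet_eq hL hz, smul_eq_mul]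
  · exact fun S _ => (integrable_const _).indicator (measurableSet_roundedSet z (· = S))

lemma integral_rk_roundedSet (M : Matroid E) {L : ℝ} (hL : 0 < L) {z : E → ℝ}
    (hz : ∀ e, 0 ≤ z e) :
    ∫ τ, (rk M (roundedSet z τ) : ℝ) ∂(thresholdLaw E L) =
      expectedRank M fun e => min 1 (L * z e) :=
  integral_roundedSet hL hz fun S => (rk M S : ℝ)

/-- Thresholds common to both vectors couple the two samples. -/
lemma expectedRank_mono (M : Matroid E) {p q : E → ℝ} (hp : ∀ e, 0 ≤ p e) (hpq : p ≤ q)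
    (hq : ∀ e, q e ≤ 1) : expectedRank M p ≤ expectedRank M q := by
  have h := integral_mono (integrable_comp_roundedSet_single one_pos p fun S => (rk M S : ℝ))
    (integrable_comp_roundedSet_single one_pos q fun S => (rk M S : ℝ))
    fun τ => Nat.cast_le.2 (rk_mono M (roundedSet_mono hpq τ))
  rw [integral_rk_roundedSet M one_pos hp,
    integral_rk_roundedSet M one_pos fun e => (hp e).trans (hpq e)] at h
  simp only [one_mul, min_eq_right (hq _), min_eq_right ((hpq _).trans (hq _))] at h
  exact h

lemma le_expectedRank_min {M : Matroid E} (hM : M.E = Set.univ) {z : E → ℝ}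
    (hz : z ∈ basePolytope M) {L : ℝ} (hL : 0 ≤ L) :
    (1 - Real.exp (-L)) * (rank M : ℝ) ≤ expectedRank M fun e => min 1 (L * z e) := by
  refine (le_expectedRank_arrivalProb hM hz hL).trans (expectedRank_mono M ?_ ?_ ?_)
  · intro e
    have : Real.exp (-(L * z e)) ≤ 1 :=
      Real.exp_le_one_iff.2 (neg_nonpos.2 (mul_nonneg hL (hz.1.1 e)))
    simpa [arrivalProb] using this
  · intro e
    refine le_min ?_ ?_
    · simpa [arrivalProb] using (Real.exp_pos (-(L * z e))).le
    · have := Real.add_one_le_exp (-(L * z e))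
      rw [arrivalProb]
      linarith
  · exact fun e => min_le_left _ _

lemma le_expectedRank {M : Matroid E} (hM : M.E = Set.univ) {z : E → ℝ}
    (hz : z ∈ basePolytope M) :
    (1 - 1 / Real.exp 1) * (rank M : ℝ) ≤ expectedRank M z := by
  have h := le_expectedRank_min hM hz zero_le_one
  have hz1 : ∀ e, z e ≤ 1 := fun e => by
    have h1 := hz.1.2 {e}
    rw [sum_singleton] at h1
    exact h1.trans (by exact_mod_cast rk_singleton_le_one M e)
  simpa only [one_mul, min_eq_right (hz1 _), Real.exp_neg, ← one_div] using h

/-- Markov's inequality for the missing rank, which is at least one when the rounded set is not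
spanning. -/
lemma measureReal_not_spanning_le {M : Matroid E} (hM : M.E = Set.univ) {z : E → ℝ}
    (hz : z ∈ basePolytope M) {L : ℝ} (hL : 0 < L) :
    (thresholdLaw E L).real {τ | ¬ M.Spanning (roundedSet z τ : Set E)} ≤
      Real.exp (-L) * rank M := by
  have := isProbabilityMeasure_thresholdLaw (E := E) hL
  have hmeas := measurableSet_roundedSet z fun S => ¬ M.Spanning (S : Set E)
  have hint := integrable_comp_roundedSet_single hL z fun S => (rank M : ℝ) - rk M S
  have h : (thresholdLaw E L).real {τ | ¬ M.Spanning (roundedSet z τ : Set E)} ≤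
      ∫ τ, ((rank M : ℝ) - rk M (roundedSet z τ)) ∂(thresholdLaw E L) := by
    rw [← integral_indicator_one hmeas]
    refine integral_mono ((integrable_const 1).indicator hmeas) hint fun τ => ?_
    refine Set.indicator_apply_le' (fun hτ => ?_) fun _ => ?_
    · rw [Set.mem_ofPred_eq, spanning_iff_rk hM, not_le, Nat.lt_iff_add_one_le] at hτ
      have : (rk M (roundedSet z τ) : ℝ) + 1 ≤ rank M := by exact_mod_cast hτ
      simp only [Pi.one_apply]
      linarith
    · exact sub_nonneg.2 (Nat.cast_le.2 (rk_le_rank M _))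
  refine h.trans ?_
  rw [integral_sub (integrable_const _)
    (integrable_comp_roundedSet_single hL z fun S => (rk M S : ℝ)), integral_const,
    integral_rk_roundedSet M hL hz.1.1]
  have h2 := le_expectedRank_min hM hz hL.le
  simp only [probReal_univ, one_smul]
  linarith

/-- The failure probability is at most `r * exp (-L) = r * (r * T) ^ (-32)`, where `r ≤ r * T`. -/
lemma le_measureReal_spanning {M : Matroid E}
    (hM : M.E = Set.univ) {T : ℕ} (hrT : 2 ≤ rank M * T) {z : E → ℝ} (hz : z ∈ basePolytope M) :
    1 - 1 / ((rank M : ℝ) * (T : ℝ)) ^ 8 ≤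
      (thresholdLaw E (32 * Real.log ((rank M : ℝ) * (T : ℝ)))).real
        {τ | M.Spanning (roundedSet z τ : Set E)} := by
  classical
  have hn : (2 : ℝ) ≤ (rank M : ℝ) * T := by exact_mod_cast hrT
  have hrn : (rank M : ℝ) ≤ (rank M : ℝ) * T := by
    have : 1 ≤ T := Nat.pos_of_ne_zero (by rintro rfl; simp at hrT)
    exact le_mul_of_one_le_right (Nat.cast_nonneg _) (by exact_mod_cast this)
  set n : ℝ := (rank M : ℝ) * T
  have hn0 : 0 < n := by linarith
  have hL : 0 < 32 * Real.log n := mul_pos (by norm_num) (Real.log_pos (by linarith))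
  have := isProbabilityMeasure_thresholdLaw (E := E) hL
  have h1 := measureReal_not_spanning_le hM hz hL
  have h2 := probReal_compl_eq_one_sub (μ := thresholdLaw E (32 * Real.log n))
    (measurableSet_roundedSet z fun S => M.Spanning (S : Set E))
  rw [Set.compl_ofPred] at h2
  have h3 : Real.exp (-(32 * Real.log n)) = 1 / n ^ 32 := by
    rw [Real.exp_neg, one_div, mul_comm, Real.exp_mul, Real.exp_log hn0]
    norm_cast
  have h4 : 1 / n ^ 32 * (rank M : ℝ) ≤ 1 / n ^ 8 := by
    rw [one_div_mul_eq_div, div_le_div_iff₀ (by positivity) (by positivity), one_mul]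
    calc (rank M : ℝ) * n ^ 8 ≤ n * n ^ 8 := by gcongr
      _ = n ^ 9 := by ring
      _ ≤ n ^ 32 := pow_le_pow_right₀ (by linarith) (by norm_num)
  rw [h3] at h1
  linarith

end Threshold

/-! ### Cost of the rounded solution -/

section Cost

lemma sum_sdiff_le_sum_sdiff_add {E : Type*} [DecidableEq E] {a : E → ℝ} (ha : ∀ e, 0 ≤ a e)
    {S X P Q : Finset E} (hPQ : P ⊆ Q) :
    ∑ e ∈ S \ Q, a e ≤ ∑ e ∈ X \ P, a e + ∑ e ∈ S \ X, a e := by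
  have hsub : S \ Q ⊆ (X \ P) ∪ (S \ X) := by
    intro e he
    have hS := mem_sdiff.1 he
    by_cases hX : e ∈ X
    · exact mem_union_left _ (mem_sdiff.2 ⟨hX, fun h => hS.2 (hPQ h)⟩)
    · exact mem_union_right _ (mem_sdiff.2 ⟨hS.1, hX⟩)
  refine (sum_le_sum_of_subset_of_nonneg hsub fun e _ _ => ha e).trans ?_
  rw [← sum_union_inter]
  exact le_add_of_nonneg_right (sum_nonneg fun e _ => ha e)

lemma prev_empty_subset {E : Type*} {T : ℕ} {X S : Fin T → Finset E} (h : ∀ t, X t ⊆ S t)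
    (t : Fin T) : prev ∅ X t ⊆ prev ∅ S t := by
  unfold prev
  split_ifs
  · exact Subset.rfl
  · exact h _

variable {E : Type*} [Fintype E]

lemma exists_isAugmentationRule [DecidableEq E] {M : Matroid E} (hM : M.E = Set.univ) {T : ℕ}
    {a : E → ℝ} {c : Fin T → E → ℝ} (ha : ∀ e, 0 ≤ a e) (hc : ∀ t e, 0 ≤ c t e) :
    ∃ aug : Fin T → Finset E → Finset E, IsAugmentationRule M a c aug := by
  classical
  have h : ∀ (t : Fin T) (X : Finset E),
      ∃ Y, IsCheapestAugmentation M (fun e => c t e + a e) X Y := by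
    intro t X
    by_cases hX : M.Spanning (X : Set E)
    · exact ⟨X, Subset.rfl, hX, fun _ => rfl, fun Z _ _ => by
        rw [sdiff_self, bot_eq_empty, sum_empty]
        exact sum_nonneg fun e _ => add_nonneg (hc t e) (ha e)⟩
    · obtain ⟨Y, hY, hmin⟩ := exists_min_image
        (univ.filter fun Z : Finset E => X ⊆ Z ∧ M.Spanning (Z : Set E))
        (fun Z => ∑ e ∈ Z \ X, (c t e + a e))
        ⟨univ, mem_filter.2 ⟨mem_univ _, subset_univ _, spanning_univ hM⟩⟩
      have hY' := (mem_filter.1 hY).2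
      exact ⟨Y, hY'.1, hY'.2, fun h => absurd h hX, fun Z hXZ hZ =>
        hmin Z (mem_filter.2 ⟨mem_univ _, hXZ, hZ⟩)⟩
  choose aug haug using h
  exact ⟨aug, haug⟩

/-- The cost of an augmented solution is at most the cost of the sets themselves plus, at each
time when the set is not spanning, the weight of an arbitrary spanning set `B t`. -/
lemma msmCost_aug_le [DecidableEq E] {M : Matroid E} {T : ℕ} {a : E → ℝ} {c : Fin T → E → ℝ}
    (ha : ∀ e, 0 ≤ a e) (hc : ∀ t e, 0 ≤ c t e) {aug : Fin T → Finset E → Finset E}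
    (haug : IsAugmentationRule M a c aug) {B : Fin T → Finset E}
    (hB : ∀ t, M.Spanning (B t : Set E)) (hM : M.E = Set.univ) (X : Fin T → Finset E) :
    msmCost a c (fun t => aug t (X t)) ≤ msmCost a c X +
      ∑ t, Set.indicator {Y : Finset E | ¬ M.Spanning (Y : Set E)}
        (fun _ => ∑ e ∈ B t, (c t e + a e)) (X t) := by
  rw [msmCost, msmCost, ← sum_add_distrib]
  refine sum_le_sum fun t _ => ?_
  have h := haug t (X t)
  have h1 := sum_sdiff_le_sum_sdiff_add ha (S := aug t (X t)) (X := X t)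
    (prev_empty_subset (fun t => (haug t (X t)).subset) t)
  have h2 := sum_sdiff (f := c t) h.subset
  have h3 : ∑ e ∈ aug t (X t) \ X t, (c t e + a e) ≤
      Set.indicator {Y : Finset E | ¬ M.Spanning (Y : Set E)}
        (fun _ => ∑ e ∈ B t, (c t e + a e)) (X t) := by
    by_cases hX : M.Spanning (X t : Set E)
    · rw [h.eq_of_spanning hX, sdiff_self, bot_eq_empty, sum_empty]
      exact Set.indicator_nonneg (fun _ _ => sum_nonneg fun e _ => add_nonneg (hc t e) (ha e)) _
    · rw [Set.indicator_of_mem (by exact hX)]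
      refine (h.cheapest (X t ∪ B t) subset_union_left ?_).trans ?_
      · exact (hB t).superset (by simp) (by simp [hM])
      · refine sum_le_sum_of_subset_of_nonneg ?_ fun e _ _ => add_nonneg (hc t e) (ha e)
        rw [union_sdiff_left]
        exact sdiff_subset
  rw [sum_add_distrib] at h3
  linarith

lemma integral_sum_roundedSet_le {L : ℝ} (hL : 0 < L) {z w : E → ℝ} (hz : ∀ e, 0 ≤ z e)
    (hw : ∀ e, 0 ≤ w e) :
    ∫ τ, ∑ e ∈ roundedSet z τ, w e ∂(thresholdLaw E L) ≤ L * ∑ e, w e * z e := by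
  have := isProbabilityMeasure_thresholdLaw (E := E) hL
  classical
  have hmeas : ∀ e, MeasurableSet {τ : E → ℝ | e ∈ roundedSet z τ} := fun e =>
    measurableSet_roundedSet z (e ∈ ·)
  have h : ∀ τ, ∑ e ∈ roundedSet z τ, w e =
      ∑ e, Set.indicator {τ | e ∈ roundedSet z τ} (fun _ => w e) τ := fun τ => by
    simp [Set.indicator_apply]
  simp_rw [h]
  rw [integral_finsetSum _ fun e _ => (integrable_const _).indicator (hmeas e), mul_sum]
  refine sum_le_sum fun e _ => ?_
  rw [integral_indicator_const _ (hmeas e), smul_eq_mul]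
  simp only [mem_roundedSet]
  have h1 := measureReal_thresholdLaw_eval hL e (measurableSet_Iic (a := z e))
  rw [cond_Icc_real_Iic hL (hz e)] at h1
  change Measure.real _ {τ : E → ℝ | τ e ∈ Set.Iic (z e)} * _ ≤ _
  rw [h1]
  calc min 1 (L * z e) * w e ≤ L * z e * w e :=
        mul_le_mul_of_nonneg_right (min_le_right _ _) (hw e)
    _ = L * (w e * z e) := by ring

lemma integral_sum_roundedSet_sdiff_le [DecidableEq E] {L : ℝ} (hL : 0 < L) {z z' w : E → ℝ}
    (hw : ∀ e, 0 ≤ w e) :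
    ∫ τ, ∑ e ∈ roundedSet z τ \ roundedSet z' τ, w e ∂(thresholdLaw E L) ≤
      L * ∑ e, w e * max (z e - z' e) 0 := by
  have := isProbabilityMeasure_thresholdLaw (E := E) hL
  have hmeas : ∀ e, MeasurableSet {τ : E → ℝ | e ∈ roundedSet z τ \ roundedSet z' τ} := fun e => by
    simp only [mem_sdiff]
    exact (measurableSet_roundedSet z (e ∈ ·)).inter (measurableSet_roundedSet z' (e ∉ ·))
  have h : ∀ τ, ∑ e ∈ roundedSet z τ \ roundedSet z' τ, w e =
      ∑ e, Set.indicator {τ | e ∈ roundedSet z τ \ roundedSet z' τ} (fun _ => w e) τ :=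
    fun τ => by simp only [Set.indicator_apply, Set.mem_ofPred_eq, sum_ite_mem, univ_inter]
  simp_rw [h]
  rw [integral_finsetSum _ fun e _ => (integrable_const _).indicator (hmeas e), mul_sum]
  refine sum_le_sum fun e _ => ?_
  rw [integral_indicator_const _ (hmeas e), smul_eq_mul]
  have h1 : {τ : E → ℝ | e ∈ roundedSet z τ \ roundedSet z' τ} =
      {τ | τ e ∈ Set.Ioc (z' e) (z e)} := by
    ext τ
    simp [mem_roundedSet, and_comm]
  rw [h1, measureReal_thresholdLaw_eval hL e measurableSet_Ioc]
  calc _ ≤ L * max (z e - z' e) 0 * w e :=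
        mul_le_mul_of_nonneg_right (cond_Icc_real_Ioc_le hL) (hw e)
    _ = L * (w e * max (z e - z' e) 0) := by ring

/-- Before augmentation, rounding loses a factor `L` in expectation: the element `e` is acquired at
time `t` only if its threshold lies between two consecutive values of `z`. -/
lemma integral_msmCost_roundedSet_le [DecidableEq E] {M : Matroid E} {T : ℕ} {a : E → ℝ}
    {c : Fin T → E → ℝ} (ha : ∀ e, 0 ≤ a e) (hc : ∀ t e, 0 ≤ c t e) {y z : Fin T → E → ℝ}
    (hyz : LPFeasible M y z) {L : ℝ} (hL : 0 < L) :
    ∫ τ, msmCost a c (fun t => roundedSet (z t) τ) ∂(thresholdLaw E L) ≤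
      L * lpValue a c y z := by
  unfold msmCost
  rw [integral_finsetSum _ fun t _ => integrable_comp_roundedSet hL z fun X =>
    ∑ e ∈ X t, c t e + ∑ e ∈ X t \ prev ∅ X t, a e, lpValue, ← sum_add_distrib, mul_sum]
  refine sum_le_sum fun t _ => ?_
  rw [integral_add (integrable_comp_roundedSet hL z fun X => ∑ e ∈ X t, c t e)
    (integrable_comp_roundedSet hL z fun X => ∑ e ∈ X t \ prev ∅ X t, a e), mul_add, add_comm]
  refine add_le_add ?_ (integral_sum_roundedSet_le hL (hyz.z_nonneg t) (hc t))
  have hacq := hyz.acquire t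
  unfold prev at hacq ⊢
  split_ifs at hacq ⊢ with ht
  · simp only [sdiff_empty]
    refine (integral_sum_roundedSet_le hL (hyz.z_nonneg t) ha).trans ?_
    refine mul_le_mul_of_nonneg_left (sum_le_sum fun e _ => ?_) hL.le
    exact mul_le_mul_of_nonneg_left (by simpa using hacq e) (ha e)
  · refine (integral_sum_roundedSet_sdiff_le hL ha).trans ?_
    refine mul_le_mul_of_nonneg_left (sum_le_sum fun e _ => ?_) hL.le
    exact mul_le_mul_of_nonneg_left (max_le (hacq e) (hyz.y_nonneg t e)) (ha e)

/-- The rounded set has expected weight at most `L * ∑ e, w e * z e` and is spanning half of the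
time, which bounds the minimum weight of a spanning set. -/
lemma exists_spanning_sum_le [DecidableEq E] {M : Matroid E} (hM : M.E = Set.univ) {L : ℝ}
    (hL : 0 < L) {z w : E → ℝ} (hz : ∀ e, 0 ≤ z e) (hw : ∀ e, 0 ≤ w e)
    (hspan : 1 / 2 ≤ (thresholdLaw E L).real {τ | M.Spanning (roundedSet z τ : Set E)}) :
    ∃ B : Finset E, M.Spanning (B : Set E) ∧ ∑ e ∈ B, w e ≤ 2 * L * ∑ e, w e * z e := by
  have := isProbabilityMeasure_thresholdLaw (E := E) hL
  classical
  obtain ⟨B, hB, hmin⟩ := exists_min_image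
    (univ.filter fun Z : Finset E => M.Spanning (Z : Set E)) (fun Z => ∑ e ∈ Z, w e)
    ⟨univ, mem_filter.2 ⟨mem_univ _, spanning_univ hM⟩⟩
  refine ⟨B, (mem_filter.1 hB).2, ?_⟩
  have hmeas := measurableSet_roundedSet z fun S => M.Spanning (S : Set E)
  have h : ∫ τ, Set.indicator {τ | M.Spanning (roundedSet z τ : Set E)}
      (fun _ => ∑ e ∈ B, w e) τ ∂(thresholdLaw E L) ≤
      ∫ τ, ∑ e ∈ roundedSet z τ, w e ∂(thresholdLaw E L) := by
    refine integral_mono ((integrable_const _).indicator hmeas)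
      (integrable_comp_roundedSet_single hL z fun S => ∑ e ∈ S, w e) fun τ => ?_
    refine Set.indicator_apply_le' (fun hτ => ?_) fun _ => sum_nonneg fun e _ => hw e
    exact hmin _ (mem_filter.2 ⟨mem_univ _, hτ⟩)
  rw [integral_indicator_const _ hmeas, smul_eq_mul] at h
  have h2 := h.trans (integral_sum_roundedSet_le hL hz hw)
  have h3 := mul_le_mul_of_nonneg_right hspan (sum_nonneg fun e (_ : e ∈ B) => hw e)
  linarith

lemma LPFeasible.z_le_sum_y {M : Matroid E} {T : ℕ} {y z : Fin T → E → ℝ}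
    (h : LPFeasible M y z) (t : Fin T) (e : E) : z t e ≤ ∑ s, y s e := by
  have key : ∀ (n : ℕ) (hn : n < T),
      z ⟨n, hn⟩ e ≤ ∑ s ∈ univ.filter (fun s : Fin T => s.val ≤ n), y s e := by
    intro n
    induction n with
    | zero =>
      intro hn
      have h1 := h.acquire ⟨0, hn⟩ e
      have h2 : z ⟨0, hn⟩ e ≤ y ⟨0, hn⟩ e := by simpa [prev] using h1
      exact h2.trans (single_le_sum (f := fun s => y s e) (fun s _ => h.y_nonneg s e)
        (mem_filter.2 ⟨mem_univ _, le_rfl⟩))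
    | succ n ih =>
      intro hn
      have h1 := h.acquire ⟨n + 1, hn⟩ e
      have h2 : z ⟨n + 1, hn⟩ e - z ⟨n, Nat.lt_of_succ_lt hn⟩ e ≤ y ⟨n + 1, hn⟩ e := by
        simpa [prev] using h1
      have h3 : univ.filter (fun s : Fin T => s.val ≤ n + 1) =
          insert ⟨n + 1, hn⟩ (univ.filter fun s : Fin T => s.val ≤ n) := by
        ext s
        simp only [mem_filter, mem_univ, true_and, mem_insert, Fin.ext_iff]
        omega
      rw [h3, sum_insert (by simp)]
      linarith [ih (Nat.lt_of_succ_lt hn)]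
  exact (key t.val t.isLt).trans
    (sum_le_sum_of_subset_of_nonneg (filter_subset _ _) fun s _ _ => h.y_nonneg s e)

/-- Whatever `z` holds at some time was acquired earlier, so the acquisition costs of `z t` are paid
for by `y`. Summed over time, the weights `c t + a` lose at most a factor `T`. -/
lemma LPFeasible.sum_weight_le {M : Matroid E} {T : ℕ} {a : E → ℝ} {c : Fin T → E → ℝ}
    (ha : ∀ e, 0 ≤ a e) (hc : ∀ t e, 0 ≤ c t e) {y z : Fin T → E → ℝ} (h : LPFeasible M y z) :
    ∑ t, ∑ e, (c t e + a e) * z t e ≤ T * lpValue a c y z := by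
  set V := ∑ t, ∑ e, a e * y t e with hV
  set W := ∑ t, ∑ e, c t e * z t e with hW
  have hW0 : 0 ≤ W := sum_nonneg fun t _ => sum_nonneg fun e _ =>
    mul_nonneg (hc t e) (h.z_nonneg t e)
  have h1 : ∀ t, ∑ e, a e * z t e ≤ V := fun t => by
    rw [hV, sum_comm]
    refine sum_le_sum fun e _ => ?_
    rw [← mul_sum]
    exact mul_le_mul_of_nonneg_left (h.z_le_sum_y t e) (ha e)
  have h2 : ∑ t, ∑ e, a e * z t e ≤ T * V := by
    simpa using sum_le_card_nsmul univ _ V fun t _ => h1 t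
  have h3 : W ≤ T * W := by
    rcases Nat.eq_zero_or_pos T with rfl | hT
    · simp [hW]
    · exact le_mul_of_one_le_left hW0 (by exact_mod_cast hT)
  simp only [add_mul, sum_add_distrib]
  rw [lpValue, mul_add]
  linarith

lemma lpValue_nonneg {M : Matroid E} {T : ℕ} {a : E → ℝ} {c : Fin T → E → ℝ}
    (ha : ∀ e, 0 ≤ a e) (hc : ∀ t e, 0 ≤ c t e) {y z : Fin T → E → ℝ} (h : LPFeasible M y z) :
    0 ≤ lpValue a c y z :=
  add_nonneg
    (sum_nonneg fun t _ => sum_nonneg fun e _ => mul_nonneg (ha e) (h.y_nonneg t e))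
    (sum_nonneg fun t _ => sum_nonneg fun e _ => mul_nonneg (hc t e) (h.z_nonneg t e))

/-- If the rounded set fails to span with probability at most `δ ≤ 1 / 2` at every time, then the
augmentations cost in expectation at most `δ` times the weight of cheap spanning sets. -/
lemma integral_msmCost_roundedSolution_le [DecidableEq E] {M : Matroid E} (hM : M.E = Set.univ)
    {T : ℕ} {a : E → ℝ} {c : Fin T → E → ℝ} (ha : ∀ e, 0 ≤ a e) (hc : ∀ t e, 0 ≤ c t e)
    {y z : Fin T → E → ℝ} (hyz : LPFeasible M y z) {L δ : ℝ} (hL : 0 < L) (hδ : δ ≤ 1 / 2)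
    (hδT : δ * T ≤ 1)
    (hspan : ∀ t, 1 - δ ≤ (thresholdLaw E L).real {τ | M.Spanning (roundedSet (z t) τ : Set E)})
    {aug : Fin T → Finset E → Finset E} (haug : IsAugmentationRule M a c aug) :
    ∫ τ, msmCost a c (roundedSolution aug z τ) ∂(thresholdLaw E L) ≤
      3 * L * lpValue a c y z := by
  have := isProbabilityMeasure_thresholdLaw (E := E) hL
  have hw : ∀ t e, 0 ≤ c t e + a e := fun t e => add_nonneg (hc t e) (ha e)
  choose B hB hBw using fun t => exists_spanning_sum_le hM hL (hyz.z_nonneg t) (hw t)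
    ((by linarith : (1 : ℝ) / 2 ≤ 1 - δ).trans (hspan t))
  have hmeas : ∀ t, MeasurableSet {τ | ¬ M.Spanning (roundedSet (z t) τ : Set E)} := fun t =>
    measurableSet_roundedSet (z t) fun S => ¬ M.Spanning (S : Set E)
  have hfail : ∀ t,
      (thresholdLaw E L).real {τ | ¬ M.Spanning (roundedSet (z t) τ : Set E)} ≤ δ := fun t => by
    have h1 := hspan t
    have h2 := probReal_compl_eq_one_sub (μ := thresholdLaw E L)
      (measurableSet_roundedSet (z t) fun S => M.Spanning (S : Set E))
    rw [Set.compl_ofPred] at h2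
    linarith
  have hδ0 : ∀ _ : Fin T, 0 ≤ δ := fun t => measureReal_nonneg.trans (hfail t)
  have hind := fun t => integrable_comp_roundedSet_single hL (z t)
    (Set.indicator {Y : Finset E | ¬ M.Spanning (Y : Set E)} fun _ => ∑ e ∈ B t, (c t e + a e))
  have haugm : ∀ t, ∫ τ, Set.indicator {Y : Finset E | ¬ M.Spanning (Y : Set E)}
      (fun _ => ∑ e ∈ B t, (c t e + a e)) (roundedSet (z t) τ) ∂(thresholdLaw E L) ≤
      2 * L * δ * ∑ e, (c t e + a e) * z t e := fun t => by
    have h1 := integral_indicator_const (μ := thresholdLaw E L)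
      (∑ e ∈ B t, (c t e + a e)) (hmeas t)
    change (∫ τ, Set.indicator {τ | ¬ M.Spanning (roundedSet (z t) τ : Set E)}
      (fun _ => ∑ e ∈ B t, (c t e + a e)) τ ∂(thresholdLaw E L)) ≤ _
    rw [h1, smul_eq_mul]
    have h2 := mul_le_mul (hfail t) (hBw t) (sum_nonneg fun e _ => hw t e) (hδ0 t)
    linarith
  calc ∫ τ, msmCost a c (roundedSolution aug z τ) ∂(thresholdLaw E L)
      ≤ ∫ τ, (msmCost a c (fun t => roundedSet (z t) τ) +
          ∑ t, Set.indicator {Y : Finset E | ¬ M.Spanning (Y : Set E)}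
            (fun _ => ∑ e ∈ B t, (c t e + a e)) (roundedSet (z t) τ)) ∂(thresholdLaw E L) := by
        refine integral_mono
          (integrable_comp_roundedSet hL z fun X => msmCost a c fun t => aug t (X t))
          ((integrable_comp_roundedSet hL z fun X => msmCost a c X).add
            (integrable_finsetSum _ fun t _ => hind t)) fun τ => ?_
        exact msmCost_aug_le ha hc haug hB hM _
    _ ≤ L * lpValue a c y z + ∑ t, 2 * L * δ * ∑ e, (c t e + a e) * z t e := by
        rw [integral_add (integrable_comp_roundedSet hL z fun X => msmCost a c X)
          (integrable_finsetSum _ fun t _ => hind t), integral_finsetSum _ fun t _ => hind t]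
        exact add_le_add (integral_msmCost_roundedSet_le ha hc hyz hL)
          (sum_le_sum fun t _ => haugm t)
    _ ≤ 3 * L * lpValue a c y z := by
        have hV := lpValue_nonneg ha hc hyz
        have hsum : ∑ t, 2 * L * δ * ∑ e, (c t e + a e) * z t e ≤ 2 * L * lpValue a c y z := by
          rcases Nat.eq_zero_or_pos T with rfl | hT
          · simpa using by positivity
          · rw [← mul_sum]
            calc _ ≤ 2 * L * δ * (T * lpValue a c y z) :=
                  mul_le_mul_of_nonneg_left (hyz.sum_weight_le ha hc)
                    (mul_nonneg (by positivity) (hδ0 ⟨0, hT⟩))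
              _ = δ * T * (2 * L * lpValue a c y z) := by ring
              _ ≤ 2 * L * lpValue a c y z := mul_le_of_le_one_left (by positivity) hδT
        linarith

end Cost

end Multistage

theorem mainTheorem2 :
    (∀ (E : Type*) [Fintype E] [DecidableEq E] (M : Matroid E), M.E = Set.univ →
      ∀ z ∈ Multistage.basePolytope M,
        (1 - 1 / Real.exp 1) * (Multistage.rank M : ℝ) ≤ Multistage.expectedRank M z) ∧
    ∃ C : ℝ, 0 < C ∧
      ∀ (E : Type*) [Fintype E] [DecidableEq E] (M : Matroid E), M.E = Set.univ →
      ∀ (T : ℕ), 2 ≤ Multistage.rank M * T →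
      ∀ (a : E → ℝ) (c : Fin T → E → ℝ), (∀ e, 0 ≤ a e) → (∀ t e, 0 ≤ c t e) →
      ∀ (y z : Fin T → E → ℝ), Multistage.LPFeasible M y z →
      ∀ L : ℝ, L = 32 * Real.log ((Multistage.rank M : ℝ) * (T : ℝ)) →
        (∀ t : Fin T,
          1 - 1 / ((Multistage.rank M : ℝ) * (T : ℝ)) ^ 8 ≤
            (Multistage.thresholdLaw E L).real
              {τ | M.Spanning (Multistage.roundedSet (z t) τ : Set E)}) ∧
        (∃ aug : Fin T → Finset E → Finset E, Multistage.IsAugmentationRule M a c aug) ∧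
        ∀ aug : Fin T → Finset E → Finset E, Multistage.IsAugmentationRule M a c aug →
          (∀ τ : E → ℝ, Multistage.IsMSMSolution M (Multistage.roundedSolution aug z τ)) ∧
          MeasureTheory.Integrable
            (fun τ => Multistage.msmCost a c (Multistage.roundedSolution aug z τ))
            (Multistage.thresholdLaw E L) ∧
          ∫ τ, Multistage.msmCost a c (Multistage.roundedSolution aug z τ)
              ∂(Multistage.thresholdLaw E L) ≤
            C * Real.log ((Multistage.rank M : ℝ) * (T : ℝ)) * Multistage.lpValue a c y z := by
  -- `96 = 3 * 32`: the factor of `integral_msmCost_roundedSolution_le` times `L / log (r * T)`.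
  refine ⟨fun E _ _ M hM z hz => Multistage.le_expectedRank hM hz, 96, by norm_num, ?_⟩
  intro E _ _ M hM T hrT a c ha hc y z hyz L hLdef
  have hn : (2 : ℝ) ≤ (Multistage.rank M : ℝ) * T := by exact_mod_cast hrT
  have hspan : ∀ t : Fin T, 1 - 1 / ((Multistage.rank M : ℝ) * (T : ℝ)) ^ 8 ≤
      (Multistage.thresholdLaw E L).real
        {τ | M.Spanning (Multistage.roundedSet (z t) τ : Set E)} := fun t => by
    rw [hLdef]
    exact Multistage.le_measureReal_spanning hM hrT (hyz.mem_base t)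
  have hTn : (T : ℝ) ≤ (Multistage.rank M : ℝ) * T := by
    have : 1 ≤ Multistage.rank M := Nat.pos_of_ne_zero fun h => by simp [h] at hrT
    exact le_mul_of_one_le_left (Nat.cast_nonneg _) (by exact_mod_cast this)
  have hL : 0 < L := by
    rw [hLdef]
    exact mul_pos (by norm_num) (Real.log_pos (by linarith))
  refine ⟨hspan, Multistage.exists_isAugmentationRule hM ha hc,
    fun aug haug => ⟨fun τ t => (haug t _).spanning,
      Multistage.integrable_comp_roundedSet hL z fun X =>
        Multistage.msmCost a c fun t => aug t (X t), ?_⟩⟩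
  set n : ℝ := (Multistage.rank M : ℝ) * T
  have hpow : n ≤ n ^ 8 := le_self_pow₀ (by linarith) (by norm_num)
  refine (Multistage.integral_msmCost_roundedSolution_le hM ha hc hyz hL
    (one_div_le_one_div_of_le two_pos (hn.trans hpow)) ?_ hspan haug).trans_eq ?_
  · rw [one_div_mul_eq_div]
    exact div_le_one_of_le₀ (hTn.trans hpow) (by positivity)
  · rw [hLdef]
    ring
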